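/- Let $d_1,d_2,d_3$ be positive integers and let $r\ge 0$ be the integer with $d_1+d_2+d_3=r+3$. Let $x_1,x_2,x_3$ and $a_j,b_j,c_j$ ($1\le j\le r$) be indeterminates, and let $F$ be the coefficient of $H_1^{d_1}H_2^{d_2}H_3^{d_3}$ in the formal product $$P=(x_1H_1+x_2H_2+x_3H_3)^3\prod_{j=1}^r(a_jH_1+b_jH_2+c_jH_3),$$ so that $F$ is a ternary cubic form in $x_1,x_2,x_3$ whose coefficients are polynomials in the $a_j,b_j,c_j$. Let $$H=\det\left(\frac{\partial^2F}{\partial x_p\,\partial x_q}\right)_{1\le p,q\le 3}$$ be its Hessian determinant. Then, regarded as a polynomial in the $a_j,b_j,c_j$ and $x_1,x_2,x_3$, $H$ has only positive coefficients; that is, the coefficient in $H$ of every monomial that occurs in $H$ is positive. -/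

import Mathlib

open MvPolynomial

noncomputable section

/-- Index type of the indeterminates: `Sum.inl i` stands for `x_{i+1}`, and
`Sum.inr (0, j)`, `Sum.inr (1, j)`, `Sum.inr (2, j)` stand for `a_j`, `b_j`, `c_j`,
where `j` runs over the `r` values of `Fin r`. -/
abbrev CubicVar (r : ℕ) : Type := Fin 3 ⊕ (Fin 3 × Fin r)

/-- The formal product
`P = (x₁ H₁ + x₂ H₂ + x₃ H₃)³ ∏_j (a_j H₁ + b_j H₂ + c_j H₃)`,
a polynomial in `H₁, H₂, H₃` (the outer indeterminates) whose coefficients are real polynomials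
in the `x_i, a_j, b_j, c_j` (the inner indeterminates). -/
def formalProduct (r : ℕ) : MvPolynomial (Fin 3) (MvPolynomial (CubicVar r) ℝ) :=
  (∑ i : Fin 3, C (X (Sum.inl i)) * X i) ^ 3 *
    ∏ j : Fin r, ∑ i : Fin 3, C (X (Sum.inr (i, j))) * X i

/-- The cubic `F`: the coefficient of `H₁^{d₁} H₂^{d₂} H₃^{d₃}` in the formal product, as a
polynomial in the `x_i, a_j, b_j, c_j`. -/
def cubicF (r : ℕ) (d : Fin 3 → ℕ) : MvPolynomial (CubicVar r) ℝ :=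
  (formalProduct r).coeff (Finsupp.equivFunOnFinite.symm d)

/-- The Hessian matrix of `F`: the second partial derivatives with respect to `x₁, x₂, x₃`. -/
def hessianMatrix (r : ℕ) (d : Fin 3 → ℕ) :
    Matrix (Fin 3) (Fin 3) (MvPolynomial (CubicVar r) ℝ) :=
  Matrix.of fun p q => pderiv (Sum.inl p) (pderiv (Sum.inl q) (cubicF r d))

/-- The Hessian determinant `H` of `F`. -/
def hessianDet (r : ℕ) (d : Fin 3 → ℕ) : MvPolynomial (CubicVar r) ℝ :=
  (hessianMatrix r d).det

end

/-!
The plan is to write a fixed positive multiple of `H` as a sum of monomials in the `x, a, b, c`,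
each multiplied by a real number that does not depend on them, and to show that these real numbers
are nonnegative.

Two differentiations leave `∂ₚ∂_q F` equal to `6` times the coefficient of `H ^ d` in
`H_p * H_q * G`, where `G` is the product of the linear form `x` and of the `r` linear forms
`(a_j, b_j, c_j)`. Give each row of a `3 × 3` determinant its own copy `U (k, ·)` of the variables
`H`. Then `6 * det (∂ₚ∂_q F / 6)` is the coefficient of `∏ U (k, i) ^ d i` (the *balanced*
coefficient) in `det U ^ 2 * ∏ₖ G (U (k, ·))` (`six_mul_det_coeff`). A linear form `v`, taken once
in each of the three rows, is a sum over triples of letters of `v a * v b * v c` times the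
symmetrised column `rowSym a b c`. So everything reduces to
`coeff_genDet_sq_mul_colProd_nonneg`: a balanced coefficient of `det U ^ 2` times a product of
symmetrised columns is nonnegative.

This goes by induction on the number of columns. A column `rowSym i i i` is a multiple of a monomial
and only lowers `d i`. A column `rowSym i i j` with `i ≠ j` acts, on balanced coefficients, as the
derivation `colShift i j` that replaces a letter `i` by `j` (`coeff_rowSym_mul`). This derivation
kills `det U` and maps a symmetrised column to a sum of symmetrised columns, so again one column has
disappeared. There remain the products in which every column has three different letters; then
each column equals `E + O`, where `E` and `O` are the even and odd halves of the Leibniz expansion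
and `det U = E - O`. Expanding `(E - O) ^ 2 * (E + O) ^ m` and reading off balanced coefficients
gives a positive multiple of `∑ (n choose p) ^ 3 * (3 * (p - q) ^ 2 - n)` over `p + q = n`.
Its nonnegativity (`sum_choose_cube_nonneg`) is a variance bound: moment identities express the
second moment of `t = p - q` under the weights `(n choose p) ^ 3` by the fourth, and the fourth is
controlled by comparing with the binomial distribution, because `(n choose p) ^ 2` decreases in
`|t|`.
-/

noncomputable section

/-! ### The generic matrix and symmetrised columns -/

/-- The polynomial ring in the entries of a generic `3 × 3` matrix; `X (k, i)` is the entry in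
row `k` and column `i`. -/
abbrev EntryRing : Type := MvPolynomial (Fin 3 × Fin 3) ℝ

/-- The exponent in which `X (k, i)` occurs with multiplicity `d i` for each row `k`. -/
def balancedExp (d : Fin 3 → ℕ) : (Fin 3 × Fin 3) →₀ ℕ :=
  Finsupp.equivFunOnFinite.symm fun x => d x.2

@[simp] lemma balancedExp_apply (d : Fin 3 → ℕ) (x : Fin 3 × Fin 3) :
    balancedExp d x = d x.2 := rfl

/-- The sum of the six products of one entry from column `a`, one from column `b` and one from
column `c`, the three entries lying in distinct rows. -/
def rowSym (a b c : Fin 3) : EntryRing :=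
  X (0, a) * X (1, b) * X (2, c) + X (1, a) * X (2, b) * X (0, c) + X (2, a) * X (0, b) * X (1, c) +
  X (0, a) * X (2, b) * X (1, c) + X (1, a) * X (0, b) * X (2, c) + X (2, a) * X (1, b) * X (0, c)

/-- The even half of the Leibniz expansion of the generic determinant. -/
def evenPart : EntryRing :=
  X (0, 0) * X (1, 1) * X (2, 2) + X (1, 0) * X (2, 1) * X (0, 2) + X (2, 0) * X (0, 1) * X (1, 2)

/-- The odd half of the Leibniz expansion of the generic determinant, without its sign. -/
def oddPart : EntryRing :=
  X (0, 0) * X (2, 1) * X (1, 2) + X (1, 0) * X (0, 1) * X (2, 2) + X (2, 0) * X (1, 1) * X (0, 2)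

/-- The determinant of the generic `3 × 3` matrix. -/
def genDet : EntryRing := evenPart - oddPart

/-- The derivation induced by adding a multiple of column `j` to column `i`. -/
def colShift (i j : Fin 3) : Derivation ℝ EntryRing EntryRing :=
  ∑ k : Fin 3, (X (k, j) : EntryRing) • pderiv (k, i)

lemma colShift_apply (i j : Fin 3) (f : EntryRing) :
    colShift i j f = ∑ k : Fin 3, X (k, j) * pderiv (k, i) f := by
  simp [colShift, Fin.sum_univ_three]

@[simp] lemma colShift_X (i j k l : Fin 3) :
    colShift i j (X (k, l)) = if l = i then X (k, j) else 0 := by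
  rw [colShift_apply]
  simp only [pderiv_X, Pi.single_apply, Prod.mk.injEq]
  by_cases h : l = i
  · subst h; simp
  · simp [h]

lemma colShift_genDet {i j : Fin 3} (h : i ≠ j) : colShift i j genDet = 0 := by
  simp only [genDet, evenPart, oddPart, map_sub, map_add, Derivation.leibniz, colShift_X,
    smul_eq_mul]
  fin_cases i <;> fin_cases j <;> simp at h ⊢ <;> ring

lemma colShift_rowSym (i j a b c : Fin 3) :
    colShift i j (rowSym a b c) = (if a = i then rowSym j b c else 0) +
      (if b = i then rowSym a j c else 0) + (if c = i then rowSym a b j else 0) := by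
  simp only [rowSym, map_add, Derivation.leibniz, colShift_X, smul_eq_mul]
  split_ifs <;> ring

lemma rowSym_comm₁₂ (a b c : Fin 3) : rowSym b a c = rowSym a b c := by
  simp only [rowSym]; ring

lemma rowSym_comm₂₃ (a b c : Fin 3) : rowSym a c b = rowSym a b c := by
  simp only [rowSym]; ring

/-- The product of the symmetrised columns of a multiset. -/
def colProd (s : Multiset (Fin 3 × Fin 3 × Fin 3)) : EntryRing :=
  (s.map fun t => rowSym t.1 t.2.1 t.2.2).prod

@[simp] lemma colProd_cons (t : Fin 3 × Fin 3 × Fin 3) (s : Multiset (Fin 3 × Fin 3 × Fin 3)) :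
    colProd (t ::ₘ s) = rowSym t.1 t.2.1 t.2.2 * colProd s := by simp [colProd]

@[simp] lemma colProd_zero : colProd 0 = 1 := by simp [colProd]

/-- A linear functional that is nonnegative on all products of `card s` symmetrised columns is
nonnegative on the image of such a product under a column shift. -/
lemma colShift_colProd_nonneg (i j : Fin 3) (s : Multiset (Fin 3 × Fin 3 × Fin 3)) :
    ∀ φ : EntryRing →ₗ[ℝ] ℝ,
      (∀ s', Multiset.card s' = Multiset.card s → 0 ≤ φ (colProd s')) →
      0 ≤ φ (colShift i j (colProd s)) := by
  induction s using Multiset.induction_on with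
  | empty => intro φ _; simp
  | cons t s ih =>
    intro φ hφ
    have hcons : ∀ t' : Fin 3 × Fin 3 × Fin 3,
        0 ≤ φ (colProd s * rowSym t'.1 t'.2.1 t'.2.2) := fun t' => by
      have := hφ (t' ::ₘ s) (by simp)
      rwa [colProd_cons, mul_comm] at this
    rw [colProd_cons, Derivation.leibniz, colShift_rowSym, smul_eq_mul, smul_eq_mul, map_add]
    refine add_nonneg (ih (φ ∘ₗ LinearMap.mulLeft ℝ (rowSym t.1 t.2.1 t.2.2)) fun s' hs' => ?_) ?_
    · simpa using hφ (t ::ₘ s') (by simp [hs'])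
    · simp only [mul_add, map_add]
      refine add_nonneg (add_nonneg ?_ ?_) ?_
      · split_ifs
        · exact hcons (j, t.2.1, t.2.2)
        · simp
      · split_ifs
        · exact hcons (t.1, j, t.2.2)
        · simp
      · split_ifs
        · exact hcons (t.1, t.2.1, j)
        · simp

/-- Lowering the degree in column `i`: a factor taken twice from column `i` and once from column
`j` can be traded for the derivative that turns an entry of column `i` into one of column `j`. -/
lemma coeff_mul_eq_coeff_pderiv {i j : Fin 3} (hij : i ≠ j) {k l m : Fin 3}
    (hkl : k ≠ l) (hkm : k ≠ m) (hlm : l ≠ m) (d : Fin 3 → ℕ) (g : EntryRing) :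
    (d i + 1 : ℝ) * coeff (balancedExp (d + Pi.single i 1)) (X (k, i) * X (l, i) * X (m, j) * g) =
      coeff (balancedExp d) (X (m, j) * pderiv (m, i) g) := by
  rcases Nat.eq_zero_or_pos (d j) with h0 | h0
  · rw [show (X (k, i) * X (l, i) * X (m, j) * g : EntryRing) =
      X (m, j) * (X (k, i) * X (l, i) * g) by ring, coeff_X_mul', coeff_X_mul']
    simp [h0, hij.symm]
  · set B : (Fin 3 × Fin 3) →₀ ℕ := balancedExp d - Finsupp.single (m, j) 1 with hB
    have h1 : balancedExp d = Finsupp.single (m, j) 1 + B := by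
      rw [hB, add_tsub_cancel_of_le]
      rw [Finsupp.single_le_iff]; exact h0
    have h2 : balancedExp (d + Pi.single i 1) = Finsupp.single (k, i) 1 + (Finsupp.single (l, i) 1 +
        (Finsupp.single (m, j) 1 + (B + Finsupp.single (m, i) 1))) := by
      have : balancedExp (d + Pi.single i 1) = Finsupp.single (k, i) 1 +
        (Finsupp.single (l, i) 1 + (Finsupp.single (m, i) 1 + balancedExp d)) := by
        ext ⟨x, y⟩
        simp only [balancedExp_apply, Finsupp.add_apply, Pi.add_apply, Finsupp.single_apply,
          Prod.mk.injEq, Pi.single_apply]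
        by_cases hy : y = i
        · subst hy
          have : k = x ∨ l = x ∨ m = x := by omega
          rcases this with rfl | rfl | rfl
          · simp [hkl.symm, hkm.symm]; ring
          · simp [hkl, hlm.symm]; ring
          · simp [hkm, hlm]; ring
        · simp [hy, Ne.symm hy]
      rw [this, h1]; abel_nf
    rw [h2, h1, mul_assoc, mul_assoc, coeff_X_mul, coeff_X_mul, coeff_X_mul, coeff_X_mul,
      coeff_pderiv]
    have : B (m, i) = d i := by simp [hB, hij.symm]
    rw [this]; ring

/-- On balanced coefficients, multiplication by `rowSym i i j` is a multiple of `colShift i j`. -/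
lemma coeff_rowSym_mul {i j : Fin 3} (hij : i ≠ j) (d : Fin 3 → ℕ) (g : EntryRing) :
    (d i + 1 : ℝ) * coeff (balancedExp (d + Pi.single i 1)) (rowSym i i j * g) =
      2 * coeff (balancedExp d) (colShift i j g) := by
  have key := fun (k l m : Fin 3) (h1 : k ≠ l) (h2 : k ≠ m) (h3 : l ≠ m) =>
    coeff_mul_eq_coeff_pderiv hij h1 h2 h3 d g
  simp only [rowSym, add_mul _ _ g, coeff_add, colShift_apply, Fin.sum_univ_three]
  linear_combination key 0 1 2 (by decide) (by decide) (by decide) +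
    key 1 2 0 (by decide) (by decide) (by decide) + key 2 0 1 (by decide) (by decide) (by decide) +
    key 0 2 1 (by decide) (by decide) (by decide) + key 1 0 2 (by decide) (by decide) (by decide) +
    key 2 1 0 (by decide) (by decide) (by decide)

lemma coeff_rowSym_self_mul (i : Fin 3) (d : Fin 3 → ℕ) (g : EntryRing) :
    coeff (balancedExp (d + Pi.single i 1)) (rowSym i i i * g) =
      6 * coeff (balancedExp d) g := by
  have h : balancedExp (d + Pi.single i 1) = Finsupp.single (0, i) 1 +
      (Finsupp.single (1, i) 1 + (Finsupp.single (2, i) 1 + balancedExp d)) := by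
    ext ⟨x, y⟩
    simp only [balancedExp_apply, Finsupp.add_apply, Pi.add_apply, Finsupp.single_apply,
      Prod.mk.injEq, Pi.single_apply]
    by_cases hy : y = i
    · subst hy; fin_cases x <;> simp <;> ring
    · simp [hy, Ne.symm hy]
  have h' : (rowSym i i i * g : EntryRing) = C 6 * (X (0, i) * (X (1, i) * (X (2, i) * g))) := by
    rw [show (C 6 : EntryRing) = 6 from rfl]
    simp only [rowSym]; ring
  rw [h', coeff_C_mul, h, coeff_X_mul, coeff_X_mul, coeff_X_mul]

/-- A balanced coefficient of a multiple of `rowSym i i j` vanishes unless column `i` is used. -/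
lemma coeff_rowSym_mul_eq_zero {i j : Fin 3} {d : Fin 3 → ℕ} (h : d i = 0) (g : EntryRing) :
    coeff (balancedExp d) (rowSym i i j * g) = 0 := by
  have key : ∀ (k : Fin 3) (f : EntryRing), coeff (balancedExp d) (X (k, i) * f) = 0 := by
    intro k f; rw [coeff_X_mul']; simp [h]
  simp only [rowSym, add_mul, coeff_add, mul_assoc, key, add_zero]

/-! ### A weighted binomial expansion -/

open Finset in
lemma sum_fst_mul_choose {R : Type*} [CommSemiring R] (n : ℕ) (g : ℕ → ℕ → R) :
    ∑ p ∈ antidiagonal (n + 1), (p.1 : R) * ((n + 1).choose p.1 : R) * g p.1 p.2 =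
      (n + 1) * ∑ p ∈ antidiagonal n, (n.choose p.1 : R) * g (p.1 + 1) p.2 := by
  rw [Finset.Nat.antidiagonal_succ, sum_cons, sum_map, mul_sum]
  simp only [Nat.cast_zero, zero_mul, zero_add]
  refine sum_congr rfl fun p _ => ?_
  have h := congrArg (Nat.cast : ℕ → R) (Nat.add_one_mul_choose_eq n p.1)
  push_cast at h
  simp only [Function.Embedding.prodMap, Function.Embedding.coeFn_mk, Prod.map,
    Function.Embedding.refl_apply, Nat.succ_eq_add_one]
  push_cast
  rw [← mul_assoc, h]; ring

open Finset in
/-- The square of `x - y` as a second difference: the binomial expansion of `(x + y) ^ n` weighted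
by `(a - b) ^ 2 - n` on `x ^ a * y ^ b`. -/
lemma sq_sub_mul_add_pow {R : Type*} [CommRing R] (x y : R) (m : ℕ) :
    ((m : R) + 2) * (m + 1) * ((x - y) ^ 2 * (x + y) ^ m) =
      ∑ p ∈ antidiagonal (m + 2), ((m + 2).choose p.1 : R) *
        (((p.1 : R) - p.2) ^ 2 - (m + 2)) * (x ^ p.1 * y ^ p.2) := by
  have hA : ∀ n : ℕ, (x + y) ^ n = ∑ p ∈ antidiagonal n, (n.choose p.1 : R) * (x ^ p.1 * y ^ p.2) :=
    fun n => by simp [(Commute.all x y).add_pow', nsmul_eq_mul]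
  have hB : ∀ n : ℕ, ∑ p ∈ antidiagonal (n + 1),
      (p.1 : R) * ((n + 1).choose p.1 : R) * (x ^ p.1 * y ^ p.2) = (n + 1) * x * (x + y) ^ n := by
    intro n
    rw [sum_fst_mul_choose n fun a b => x ^ a * y ^ b, hA n, mul_sum, mul_sum]
    exact sum_congr rfl fun p _ => by ring
  have hC : ∑ p ∈ antidiagonal (m + 2), (p.1 : R) * ((m + 2).choose p.1 : R) *
      (((p.1 : R) - 1) * (x ^ p.1 * y ^ p.2)) = (m + 2) * (m + 1) * x ^ 2 * (x + y) ^ m := by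
    rw [sum_fst_mul_choose (m + 1) fun a b => ((a : R) - 1) * (x ^ a * y ^ b)]
    have : ∑ p ∈ antidiagonal (m + 1), ((m + 1).choose p.1 : R) *
        (((p.1 + 1 : ℕ) : R) - 1) * (x ^ (p.1 + 1) * y ^ p.2) =
        x * ((m + 1) * x * (x + y) ^ m) := by
      rw [← hB m, mul_sum]
      exact sum_congr rfl fun p _ => by push_cast; ring
    simp only [← mul_assoc] at this ⊢
    rw [this]; push_cast; ring
  have hB' := hB (m + 1)
  have hA' := hA (m + 2)
  have hsplit : ∑ p ∈ antidiagonal (m + 2), ((m + 2).choose p.1 : R) *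
        (((p.1 : R) - p.2) ^ 2 - (m + 2)) * (x ^ p.1 * y ^ p.2) =
      4 * (∑ p ∈ antidiagonal (m + 2), (p.1 : R) * ((m + 2).choose p.1 : R) *
        (((p.1 : R) - 1) * (x ^ p.1 * y ^ p.2))) -
      4 * (m + 1) * (∑ p ∈ antidiagonal (m + 2),
        (p.1 : R) * ((m + 2).choose p.1 : R) * (x ^ p.1 * y ^ p.2)) +
      (m + 2) * (m + 1) * ∑ p ∈ antidiagonal (m + 2),
        ((m + 2).choose p.1 : R) * (x ^ p.1 * y ^ p.2) := by
    simp only [mul_sum, ← sum_sub_distrib, ← sum_add_distrib]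
    refine sum_congr rfl fun p hp => ?_
    have h := congrArg (Nat.cast : ℕ → R) (mem_antidiagonal.1 hp)
    push_cast at h
    have h2 : (p.2 : R) = m + 2 - p.1 := by rw [← h]; ring
    rw [h2]; ring
  rw [hsplit, hC, hB', ← hA']
  push_cast; ring

/-! ### Cubes of binomial coefficients -/

open Finset in
/-- Reindexing `a * choose n a = b' * choose n a'` for neighbouring splittings
`a + b = a' + b' = n`, raised to a power. -/
lemma sum_choose_pow_shift (n e : ℕ) (he : e ≠ 0) (f : ℝ → ℝ) :
    ∑ p ∈ antidiagonal n, (n.choose p.1 : ℝ) ^ e * ((p.1 : ℝ) ^ e * f (p.1 - p.2 - 1)) =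
      ∑ p ∈ antidiagonal n, (n.choose p.1 : ℝ) ^ e * ((p.2 : ℝ) ^ e * f (p.1 - p.2 + 1)) := by
  cases n with
  | zero => simp [he]
  | succ n =>
    rw [Finset.Nat.antidiagonal_succ, sum_cons, sum_map, ← Finset.Nat.antidiagonal_succ,
      Finset.Nat.antidiagonal_succ', sum_cons, sum_map]
    simp only [Nat.cast_zero, ne_eq, he, not_false_eq_true, zero_pow, zero_mul, mul_zero, zero_add]
    refine sum_congr rfl fun p hp => ?_
    have h1 := congrArg (Nat.cast : ℕ → ℝ) (Nat.add_one_mul_choose_eq n p.1)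
    have h2 := congrArg (Nat.cast : ℕ → ℝ) (Nat.choose_mul_succ_eq n p.1)
    have h3 : n + 1 - p.1 = p.2 + 1 := by have := mem_antidiagonal.1 hp; omega
    rw [h3] at h2
    push_cast at h1 h2
    simp only [Function.Embedding.prodMap, Function.Embedding.coeFn_mk, Prod.map,
      Function.Embedding.refl_apply, Nat.succ_eq_add_one]
    push_cast
    rw [← mul_assoc, ← mul_assoc, ← mul_pow, ← mul_pow, ← h1, ← h2]
    congr 1
    · ring
    · congr 1; ring

lemma choose_le_choose_of_le_half {n a b : ℕ} (hab : a ≤ b) (hb : b ≤ n / 2) :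
    n.choose a ≤ n.choose b := by
  induction b, hab using Nat.le_induction with
  | base => exact le_rfl
  | succ c hc ih =>
    exact (ih (by omega)).trans (Nat.choose_le_succ_of_lt_half_left (by omega))

open Finset in
/-- Binomial coefficients decrease with the distance from the middle. -/
lemma choose_le_choose_of_abs_le {n : ℕ} {p q : ℕ × ℕ} (hp : p ∈ antidiagonal n)
    (hq : q ∈ antidiagonal n) (h : |(p.1 : ℝ) - p.2| ≤ |(q.1 : ℝ) - q.2|) :
    n.choose q.1 ≤ n.choose p.1 := by
  obtain ⟨a, b⟩ := p
  obtain ⟨c, d⟩ := q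
  simp only [HasAntidiagonal.mem_antidiagonal] at hp hq h
  have hsymm : ∀ x y : ℕ, x + y = n → n.choose x = n.choose (min x y) := by
    intro x y hxy
    rcases le_total x y with hle | hle
    · rw [min_eq_left hle]
    · rw [min_eq_right hle, ← hxy, Nat.choose_symm_add]
  rw [hsymm a b hp, hsymm c d hq]
  have hz : |(a : ℤ) - b| ≤ |(c : ℤ) - d| := by exact_mod_cast h
  rw [abs_le] at hz
  have hz' := le_abs'.1 (le_refl |(c : ℤ) - d|)
  apply choose_le_choose_of_le_half
  · omega
  · omega

open Finset in
/-- The cubed binomial coefficients are spread out at least as much as a distribution of variance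
`n / 3` on the differences `a - b`, `a + b = n`. -/
lemma sum_choose_cube_nonneg (n : ℕ) :
    0 ≤ ∑ p ∈ antidiagonal n, (n.choose p.1 : ℝ) ^ 3 * (3 * ((p.1 : ℝ) - p.2) ^ 2 - n) := by
  rcases Nat.eq_zero_or_pos n with rfl | hn
  · simp
  have hsum : ∀ p ∈ antidiagonal n, (n : ℝ) = p.1 + p.2 := fun p hp => by
    exact_mod_cast (mem_antidiagonal.1 hp).symm
  -- Fourth moment of the cubed weights in terms of the second.
  have hcube : ∑ p ∈ antidiagonal n, (n.choose p.1 : ℝ) ^ 3 *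
      (((p.1 : ℝ) - p.2) ^ 4 - 3 * n * ((p.1 : ℝ) - p.2) ^ 2) +
      (n : ℝ) ^ 2 * ∑ p ∈ antidiagonal n, (n.choose p.1 : ℝ) ^ 3 *
        (3 * ((p.1 : ℝ) - p.2) ^ 2 - n) = 0 := by
    have h := sub_eq_zero.2 (sum_choose_pow_shift n 3 (by norm_num) fun t => t)
    rw [← sum_sub_distrib] at h
    rw [mul_sum, ← sum_add_distrib]
    calc _ = 4 * ∑ p ∈ antidiagonal n,
          ((n.choose p.1 : ℝ) ^ 3 * ((p.1 : ℝ) ^ 3 * (p.1 - p.2 - 1)) -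
            (n.choose p.1 : ℝ) ^ 3 * ((p.2 : ℝ) ^ 3 * (p.1 - p.2 + 1))) := by
          rw [mul_sum]
          refine sum_congr rfl fun p hp => ?_
          rw [hsum p hp]; ring
      _ = 0 := by rw [h, mul_zero]
  -- Fourth moment of the binomial distribution.
  have hbin : ∑ p ∈ antidiagonal n, (n.choose p.1 : ℝ) *
      (((p.1 : ℝ) - p.2) ^ 2 * (((p.1 : ℝ) - p.2) ^ 2 - (3 * n - 2))) = 0 := by
    have h := sub_eq_zero.2 (sum_choose_pow_shift n 1 (by norm_num) fun t => t ^ 3 - t)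
    rw [← sum_sub_distrib] at h
    rw [← h]
    refine sum_congr rfl fun p hp => ?_
    rw [hsum p hp]; ring
  -- `t ^ 2 * (t ^ 2 - (3 * n - 2))` changes sign once in `|t|`, and the extra weight
  -- `choose ^ 2` decreases in `|t|`; `M` is its value at the sign change.
  obtain ⟨M, hM⟩ : ∃ M : ℝ, ∀ p ∈ antidiagonal n,
      ((n.choose p.1 : ℝ) ^ 2 - M) * (((p.1 : ℝ) - p.2) ^ 2 - (3 * n - 2)) ≤ 0 := by
    by_cases hne : ((antidiagonal n).filter
        fun p => (3 * n - 2 : ℝ) ≤ ((p.1 : ℝ) - p.2) ^ 2).Nonempty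
    · obtain ⟨q, hq, hmin⟩ := exists_min_image _ (fun p : ℕ × ℕ => |(p.1 : ℝ) - p.2|) hne
      rw [mem_filter] at hq
      refine ⟨(n.choose q.1 : ℝ) ^ 2, fun p hp => ?_⟩
      by_cases hpc : (3 * n - 2 : ℝ) ≤ ((p.1 : ℝ) - p.2) ^ 2
      · have h1 := choose_le_choose_of_abs_le hq.1 hp (hmin p (mem_filter.2 ⟨hp, hpc⟩))
        have h2 : (n.choose p.1 : ℝ) ^ 2 ≤ (n.choose q.1 : ℝ) ^ 2 := by gcongr
        exact mul_nonpos_of_nonpos_of_nonneg (by linarith) (by linarith)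
      · have hlt : |(p.1 : ℝ) - p.2| ≤ |(q.1 : ℝ) - q.2| := by
          apply le_of_lt; rw [← sq_lt_sq]; linarith [hq.2]
        have h1 := choose_le_choose_of_abs_le hp hq.1 hlt
        have h2 : (n.choose q.1 : ℝ) ^ 2 ≤ (n.choose p.1 : ℝ) ^ 2 := by gcongr
        exact mul_nonpos_of_nonneg_of_nonpos (by linarith) (by linarith)
    · refine ⟨0, fun p hp => ?_⟩
      have : ¬ (3 * n - 2 : ℝ) ≤ ((p.1 : ℝ) - p.2) ^ 2 := fun h =>
        hne ⟨p, mem_filter.2 ⟨hp, h⟩⟩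
      exact mul_nonpos_of_nonneg_of_nonpos (by rw [sub_zero]; positivity) (by linarith)
  have hcheb : ∑ p ∈ antidiagonal n, (n.choose p.1 : ℝ) ^ 3 *
      (((p.1 : ℝ) - p.2) ^ 4 - 3 * n * ((p.1 : ℝ) - p.2) ^ 2) ≤ 0 := by
    calc _ ≤ ∑ p ∈ antidiagonal n, M * ((n.choose p.1 : ℝ) *
          (((p.1 : ℝ) - p.2) ^ 2 * (((p.1 : ℝ) - p.2) ^ 2 - (3 * n - 2)))) := by
          refine sum_le_sum fun p hp => ?_
          have h1 := mul_nonpos_of_nonneg_of_nonpos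
            (by positivity : (0 : ℝ) ≤ (n.choose p.1 : ℝ) * ((p.1 : ℝ) - p.2) ^ 2) (hM p hp)
          have h2 : (0 : ℝ) ≤ (n.choose p.1 : ℝ) ^ 3 * ((p.1 : ℝ) - p.2) ^ 2 := by positivity
          nlinarith
      _ = 0 := by rw [← mul_sum, hbin, mul_zero]
  have hn' : (0 : ℝ) < (n : ℝ) ^ 2 := by positivity
  by_contra hneg
  rw [not_le] at hneg
  have := mul_neg_of_pos_of_neg hn' hneg
  linarith

/-! ### Products of symmetrised columns -/

/-- The total exponent of a product of even Leibniz monomials, the monomial through the entries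
with `row - column = i` being taken `k i` times. -/
def evenExp (k : Fin 3 → ℕ) : (Fin 3 × Fin 3) →₀ ℕ :=
  Finsupp.equivFunOnFinite.symm fun x => k (x.1 - x.2)

/-- The total exponent of a product of odd Leibniz monomials, the monomial through the entries
with `row + column = i` being taken `k i` times. -/
def oddExp (k : Fin 3 → ℕ) : (Fin 3 × Fin 3) →₀ ℕ :=
  Finsupp.equivFunOnFinite.symm fun x => k (x.1 + x.2)

@[simp] lemma evenExp_apply (k : Fin 3 → ℕ) (x : Fin 3 × Fin 3) :
    evenExp k x = k (x.1 - x.2) := rfl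

@[simp] lemma oddExp_apply (k : Fin 3 → ℕ) (x : Fin 3 × Fin 3) :
    oddExp k x = k (x.1 + x.2) := rfl

lemma X_mul_X_mul_X_pow (x y z : Fin 3 × Fin 3) (n : ℕ) :
    (X x * X y * X z : EntryRing) ^ n =
      monomial (Finsupp.single x n + Finsupp.single y n + Finsupp.single z n) 1 := by
  simp only [mul_pow, X_pow_eq_monomial, monomial_mul, mul_one]

lemma evenPart_pow (a : ℕ) : evenPart ^ a = ∑ k ∈ Finset.piAntidiag Finset.univ a,
    monomial (evenExp k) (Nat.multinomial Finset.univ k : ℝ) := by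
  have h : evenPart = ∑ i : Fin 3, (X (i, 0) * X (i + 1, 1) * X (i + 2, 2) : EntryRing) := by
    simp [evenPart, Fin.sum_univ_three]
  rw [h, Finset.sum_pow_eq_sum_piAntidiag]
  refine Finset.sum_congr rfl fun k _ => ?_
  have he : ∑ i : Fin 3, (Finsupp.single (i, (0 : Fin 3)) (k i) +
      Finsupp.single (i + 1, (1 : Fin 3)) (k i) + Finsupp.single (i + 2, (2 : Fin 3)) (k i)) =
      evenExp k := by
    ext ⟨x, y⟩
    fin_cases x <;> fin_cases y <;> simp [Fin.sum_univ_three, show (-1 : Fin 3) = 2 from rfl,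
      show (-2 : Fin 3) = 1 from rfl]
  rw [← C_eq_coe_nat]
  simp only [X_mul_X_mul_X_pow]
  rw [← monomial_sum_one, he, C_mul_monomial, mul_one]

lemma oddPart_pow (a : ℕ) : oddPart ^ a = ∑ k ∈ Finset.piAntidiag Finset.univ a,
    monomial (oddExp k) (Nat.multinomial Finset.univ k : ℝ) := by
  have h : oddPart = ∑ i : Fin 3, (X (i, 0) * X (i - 1, 1) * X (i - 2, 2) : EntryRing) := by
    simp [oddPart, Fin.sum_univ_three, show (-1 : Fin 3) = 2 from rfl,
      show (-2 : Fin 3) = 1 from rfl]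
  rw [h, Finset.sum_pow_eq_sum_piAntidiag]
  refine Finset.sum_congr rfl fun k _ => ?_
  have he : ∑ i : Fin 3, (Finsupp.single (i, (0 : Fin 3)) (k i) +
      Finsupp.single (i - 1, (1 : Fin 3)) (k i) + Finsupp.single (i - 2, (2 : Fin 3)) (k i)) =
      oddExp k := by
    ext ⟨x, y⟩
    fin_cases x <;> fin_cases y <;> simp [Fin.sum_univ_three, show (-1 : Fin 3) = 2 from rfl,
      show (-2 : Fin 3) = 1 from rfl]
  rw [← C_eq_coe_nat]
  simp only [X_mul_X_mul_X_pow]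
  rw [← monomial_sum_one, he, C_mul_monomial, mul_one]

lemma coeff_evenPart_pow_mul_oddPart_pow (a b : ℕ) (e : (Fin 3 × Fin 3) →₀ ℕ) :
    coeff e (evenPart ^ a * oddPart ^ b) =
      ∑ k ∈ Finset.piAntidiag Finset.univ a, ∑ l ∈ Finset.piAntidiag Finset.univ b,
        if evenExp k + oddExp l = e then
          (Nat.multinomial Finset.univ k : ℝ) * Nat.multinomial Finset.univ l else 0 := by
  simp only [evenPart_pow, oddPart_pow, Finset.sum_mul_sum, coeff_sum, monomial_mul,
    coeff_monomial]

/-- Only constant families of multiplicities reach a balanced exponent. -/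
lemma eq_const_of_evenExp_add_oddExp {k l d : Fin 3 → ℕ}
    (h : evenExp k + oddExp l = balancedExp d) :
    (∀ i, k i = k 0) ∧ (∀ i, l i = l 0) ∧ ∀ i, d i = k 0 + l 0 := by
  have key : ∀ x y : Fin 3, k (x - y) + l (x + y) = d y := fun x y =>
    DFunLike.congr_fun h (x, y)
  have h00 : k 0 + l 0 = d 0 := key 0 0
  have h10 : k 1 + l 1 = d 0 := key 1 0
  have h20 : k 2 + l 2 = d 0 := key 2 0
  have h01 : k 2 + l 1 = d 1 := key 0 1
  have h11 : k 0 + l 2 = d 1 := key 1 1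
  have h21 : k 1 + l 0 = d 1 := key 2 1
  have h02 : k 1 + l 2 = d 2 := key 0 2
  have h12 : k 2 + l 0 = d 2 := key 1 2
  have h22 : k 0 + l 1 = d 2 := key 2 2
  refine ⟨fun i => ?_, fun i => ?_, fun i => ?_⟩ <;> fin_cases i <;> simp <;> omega

lemma exists_of_coeff_evenPart_pow_mul_oddPart_pow_ne_zero {a b : ℕ} {d : Fin 3 → ℕ}
    (h : coeff (balancedExp d) (evenPart ^ a * oddPart ^ b) ≠ 0) :
    ∃ p q : ℕ, a = 3 * p ∧ b = 3 * q ∧ d = fun _ => p + q := by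
  rw [coeff_evenPart_pow_mul_oddPart_pow] at h
  obtain ⟨k, hk, h⟩ := Finset.exists_ne_zero_of_sum_ne_zero h
  obtain ⟨l, hl, h⟩ := Finset.exists_ne_zero_of_sum_ne_zero h
  have he : evenExp k + oddExp l = balancedExp d := by
    by_contra hne; exact h (if_neg hne)
  obtain ⟨h1, h2, h3⟩ := eq_const_of_evenExp_add_oddExp he
  have hk' := (Finset.mem_piAntidiag.1 hk).1
  have hl' := (Finset.mem_piAntidiag.1 hl).1
  rw [Fin.sum_univ_three] at hk' hl'
  exact ⟨k 0, l 0, by have := h1 1; have := h1 2; omega, by have := h2 1; have := h2 2; omega,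
    funext h3⟩

lemma factorial_pow_mul_multinomial_const (p : ℕ) :
    (p.factorial : ℝ) ^ 3 * Nat.multinomial Finset.univ (fun _ : Fin 3 => p) =
      (3 * p).factorial := by
  have h := Nat.multinomial_spec (Finset.univ : Finset (Fin 3)) fun _ => p
  simp only [Finset.prod_const, Finset.sum_const, Finset.card_univ, Fintype.card_fin,
    smul_eq_mul] at h
  exact_mod_cast h

lemma coeff_const_evenPart_pow_mul_oddPart_pow (p q : ℕ) :
    ((p.factorial : ℝ) * q.factorial) ^ 3 *
      coeff (balancedExp fun _ => p + q) (evenPart ^ (3 * p) * oddPart ^ (3 * q)) =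
      (3 * p).factorial * (3 * q).factorial := by
  have hmem : ∀ n : ℕ, (fun _ => n) ∈ Finset.piAntidiag (Finset.univ : Finset (Fin 3)) (3 * n) :=
    fun n => by simp [Finset.mem_piAntidiag]
  have hconst : ∀ (n : ℕ) (k : Fin 3 → ℕ), (∀ i, k i = k 0) →
      k ∈ Finset.piAntidiag (Finset.univ : Finset (Fin 3)) (3 * n) → k = fun _ => n := by
    intro n k h hk
    have hk' := (Finset.mem_piAntidiag.1 hk).1
    rw [Fin.sum_univ_three] at hk'
    funext i
    have := h 1; have := h 2; have := h i
    omega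
  rw [coeff_evenPart_pow_mul_oddPart_pow, Finset.sum_eq_single_of_mem _ (hmem p),
    Finset.sum_eq_single_of_mem _ (hmem q), if_pos]
  · rw [← factorial_pow_mul_multinomial_const, ← factorial_pow_mul_multinomial_const]; ring
  · ext x; simp
  · intro l hl hne
    refine if_neg fun h => hne ?_
    exact hconst q l (eq_const_of_evenExp_add_oddExp h).2.1 hl
  · intro k hk hne
    refine Finset.sum_eq_zero fun l _ => if_neg fun h => hne ?_
    exact hconst p k (eq_const_of_evenExp_add_oddExp h).1 hk

open Finset in
/-- The case in which every column takes one entry of each letter: the balanced coefficient is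
zero unless `d` is constant, say `d = n` with `3 * n = m + 2`, and then it is a positive multiple of
`∑ choose n p ^ 3 * (3 * (p - q) ^ 2 - n)` over `p + q = n`. -/
lemma coeff_genDet_sq_mul_pow_nonneg (m : ℕ) (d : Fin 3 → ℕ) :
    0 ≤ coeff (balancedExp d) (genDet ^ 2 * (evenPart + oddPart) ^ m) := by
  have h := congrArg (coeff (balancedExp d)) (sq_sub_mul_add_pow evenPart oddPart m)
  have hC2 : (C 2 : EntryRing) = 2 := rfl
  have hC : ((m : EntryRing) + 2) * (m + 1) =
      (C (((m : ℝ) + 2) * (m + 1)) : EntryRing) := by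
    simp [hC2]
  have hC' : ∀ p : ℕ × ℕ, ((m + 2).choose p.1 : EntryRing) * (((p.1 : EntryRing) - p.2) ^ 2 -
      (m + 2)) =
      (C (((m + 2).choose p.1 : ℝ) * (((p.1 : ℝ) - p.2) ^ 2 - (m + 2))) : EntryRing) := fun p => by
    simp [hC2]
  simp only [hC, hC', coeff_C_mul, coeff_sum] at h
  rw [← genDet] at h
  refine nonneg_of_mul_nonneg_right (a := ((m : ℝ) + 2) * (m + 1)) ?_ (by positivity)
  rw [h]
  by_cases hd : 3 * d 0 = m + 2 ∧ d = fun _ => d 0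
  swap
  · refine (sum_eq_zero fun p hp => ?_).ge
    by_contra hne
    obtain ⟨u, v, hu, hv, huv⟩ :=
      exists_of_coeff_evenPart_pow_mul_oddPart_pow_ne_zero (right_ne_zero_of_mul hne)
    have := mem_antidiagonal.1 hp
    refine hd ⟨?_, ?_⟩
    · rw [huv]; simp only; omega
    · rw [huv]
  obtain ⟨hm, hd⟩ := hd
  generalize d 0 = n at hm hd
  have hn : (m : ℝ) + 2 = 3 * n := by exact_mod_cast hm.symm
  rw [hd, hn, ← hm]
  have himage : ∑ q ∈ antidiagonal n, (((3 * n).choose (3 * q.1) : ℝ) *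
        (((3 * q.1 : ℕ) - (3 * q.2 : ℕ) : ℝ) ^ 2 - 3 * n) *
        coeff (balancedExp fun _ => n) (evenPart ^ (3 * q.1) * oddPart ^ (3 * q.2))) =
      ∑ p ∈ antidiagonal (3 * n), ((3 * n).choose p.1 : ℝ) * (((p.1 : ℝ) - p.2) ^ 2 - 3 * n) *
        coeff (balancedExp fun _ => n) (evenPart ^ p.1 * oddPart ^ p.2) := by
    refine sum_of_injOn (fun q => (3 * q.1, 3 * q.2)) ?_ ?_ ?_ fun _ _ => rfl
    · rintro ⟨a, b⟩ - ⟨a', b'⟩ - hab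
      simp only [Prod.mk.injEq] at hab ⊢
      omega
    · rintro ⟨a, b⟩ hab
      simp only [mem_coe, HasAntidiagonal.mem_antidiagonal] at hab ⊢
      omega
    · intro p hp hnot
      by_contra hne
      obtain ⟨u, v, hu, hv, huv⟩ :=
        exists_of_coeff_evenPart_pow_mul_oddPart_pow_ne_zero (right_ne_zero_of_mul hne)
      refine hnot ⟨(u, v), ?_, ?_⟩
      · exact mem_coe.2 (mem_antidiagonal.2 (congrFun huv 0).symm)
      · simp [← hu, ← hv]
  rw [← himage]
  have hterm : ∀ q ∈ antidiagonal n, (((3 * n).choose (3 * q.1) : ℝ) *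
        (((3 * q.1 : ℕ) - (3 * q.2 : ℕ) : ℝ) ^ 2 - 3 * n) *
        coeff (balancedExp fun _ => n) (evenPart ^ (3 * q.1) * oddPart ^ (3 * q.2))) =
      (3 * (3 * n).factorial / (n.factorial : ℝ) ^ 3) *
        ((n.choose q.1 : ℝ) ^ 3 * (3 * ((q.1 : ℝ) - q.2) ^ 2 - n)) := by
    rintro ⟨p, q⟩ hpq
    rw [HasAntidiagonal.mem_antidiagonal] at hpq
    simp only at hpq ⊢
    subst hpq
    have h1 := coeff_const_evenPart_pow_mul_oddPart_pow p q
    have h2 : (((p + q).choose p : ℕ) : ℝ) * p.factorial * q.factorial = (p + q).factorial := by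
      rw [Nat.choose_symm_add]
      exact_mod_cast Nat.add_choose_mul_factorial_mul_factorial p q
    have h3 : (((3 * (p + q)).choose (3 * p) : ℕ) : ℝ) * (3 * p).factorial * (3 * q).factorial =
        (3 * (p + q)).factorial := by
      rw [mul_add, Nat.choose_symm_add]
      exact_mod_cast Nat.add_choose_mul_factorial_mul_factorial (3 * p) (3 * q)
    have hp : (p.factorial : ℝ) ≠ 0 := by positivity
    have hq : (q.factorial : ℝ) ≠ 0 := by positivity
    have hc : (((p + q).choose p : ℕ) : ℝ) ≠ 0 := by
      exact_mod_cast (Nat.choose_pos (Nat.le_add_right p q)).ne'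
    rw [← h2, ← h3]
    rw [eq_div_of_mul_eq (by positivity) ((mul_comm _ _).trans h1)]
    push_cast
    field_simp
  rw [sum_congr rfl hterm, ← mul_sum]
  exact mul_nonneg (by positivity) (sum_choose_cube_nonneg n)

lemma rowSym_eq_of_injective {a b c : Fin 3} (hab : a ≠ b) (hac : a ≠ c) (hbc : b ≠ c) :
    rowSym a b c = evenPart + oddPart := by
  fin_cases a <;> fin_cases b <;> fin_cases c <;> simp at hab hac hbc <;>
    simp [rowSym, evenPart, oddPart] <;> ring

lemma exists_of_not_injective {a b c : Fin 3} (h : ¬ (a ≠ b ∧ a ≠ c ∧ b ≠ c)) :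
    ∃ i j, rowSym a b c = rowSym i i j := by
  by_cases hab : a = b
  · exact ⟨a, c, by rw [hab]⟩
  by_cases hac : a = c
  · exact ⟨a, b, by rw [← hac, rowSym_comm₂₃]⟩
  · have hbc : b = c := by tauto
    exact ⟨b, a, by rw [← hbc, rowSym_comm₁₂ b a, rowSym_comm₂₃]⟩

/-- Balanced coefficients of the squared generic determinant times a product of symmetrised
columns are nonnegative. -/
theorem coeff_genDet_sq_mul_colProd_nonneg (s : Multiset (Fin 3 × Fin 3 × Fin 3))
    (d : Fin 3 → ℕ) : 0 ≤ coeff (balancedExp d) (genDet ^ 2 * colProd s) := by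
  induction hn : Multiset.card s generalizing s d with
  | zero =>
    rw [Multiset.card_eq_zero] at hn
    subst hn
    simpa using coeff_genDet_sq_mul_pow_nonneg 0 d
  | succ n ih =>
    by_cases hs : ∀ t ∈ s, t.1 ≠ t.2.1 ∧ t.1 ≠ t.2.2 ∧ t.2.1 ≠ t.2.2
    · have : colProd s = (evenPart + oddPart) ^ Multiset.card s := by
        rw [colProd, Multiset.map_congr rfl fun t ht =>
          rowSym_eq_of_injective (hs t ht).1 (hs t ht).2.1 (hs t ht).2.2]
        simp
      rw [this]
      exact coeff_genDet_sq_mul_pow_nonneg _ d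
    push Not at hs
    obtain ⟨t, ht, hinj⟩ := hs
    obtain ⟨s, rfl⟩ := Multiset.exists_cons_of_mem ht
    obtain ⟨i, j, hij⟩ := exists_of_not_injective (a := t.1) (b := t.2.1) (c := t.2.2) (by tauto)
    have hcard : Multiset.card s = n := by simpa using hn
    rw [colProd_cons, hij, mul_left_comm]
    rcases Nat.eq_zero_or_pos (d i) with h0 | h0
    · rw [coeff_rowSym_mul_eq_zero h0]
    obtain ⟨d, rfl⟩ : ∃ d', d = d' + Pi.single i 1 := by
      refine ⟨d - Pi.single i 1, (tsub_add_cancel_of_le fun x => ?_).symm⟩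
      by_cases hx : x = i
      · subst hx; simpa using Nat.one_le_iff_ne_zero.2 h0.ne'
      · simp [hx]
    by_cases hne : i = j
    · subst hne
      rw [coeff_rowSym_self_mul]
      exact mul_nonneg (by norm_num) (ih s d hcard)
    · refine nonneg_of_mul_nonneg_right (a := (d i + 1 : ℝ)) ?_ (by positivity)
      rw [coeff_rowSym_mul hne]
      refine mul_nonneg (by norm_num) ?_
      have hshift : colShift i j (genDet ^ 2 * colProd s) =
          genDet ^ 2 * colShift i j (colProd s) := by
        simp [Derivation.leibniz, Derivation.leibniz_pow, colShift_genDet hne]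
      rw [hshift]
      exact colShift_colProd_nonneg i j s
        (lcoeff ℝ (balancedExp d) ∘ₗ LinearMap.mulLeft ℝ (genDet ^ 2))
        fun s' hs' => ih s' d (hs'.trans hcard)

/-! ### The Hessian determinant as a balanced coefficient -/

section RowCopies

variable {R : Type*} [CommRing R]

/-- The substitution that evaluates a polynomial at the entries of row `k` of a generic matrix. -/
def inRow (k : Fin 3) : MvPolynomial (Fin 3) R →ₐ[R] MvPolynomial (Fin 3 × Fin 3) R :=
  rename fun i => (k, i)

@[simp] lemma inRow_X (k i : Fin 3) : inRow k (X i : MvPolynomial (Fin 3) R) = X (k, i) :=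
  rename_X _ _

@[simp] lemma inRow_C (k : Fin 3) (a : R) : inRow k (C a) = C a := rename_C _ _

lemma mapDomain_row_apply (k l i : Fin 3) (e : Fin 3 →₀ ℕ) :
    Finsupp.mapDomain (fun i => (k, i)) e (l, i) = if k = l then e i else 0 := by
  split_ifs with h
  · subst h
    exact Finsupp.mapDomain_apply (Prod.mk_right_injective k) e i
  · refine Finsupp.mapDomain_of_notMem_range _ _ ?_
    rintro ⟨x, hx⟩
    exact h (congrArg Prod.fst hx)

/-- A balanced coefficient of a product of polynomials in the separate rows splits. -/
lemma coeff_prod_inRow (d : Fin 3 → ℕ) (f : Fin 3 → MvPolynomial (Fin 3) R) :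
    coeff (balancedExp d) (∏ k, inRow k (f k)) =
      ∏ k, coeff (Finsupp.equivFunOnFinite.symm d) (f k) := by
  set D : Fin 3 →₀ ℕ := Finsupp.equivFunOnFinite.symm d with hD
  have hmon : ∀ (e : Fin 3 → Fin 3 →₀ ℕ) (c : Fin 3 → R),
      coeff (balancedExp d) (∏ k, inRow k (monomial (e k) (c k))) =
        ∏ k, coeff D (monomial (e k) (c k)) := by
    intro e c
    have hiff : (∑ k, Finsupp.mapDomain (fun i => (k, i)) (e k) = balancedExp d) ↔
        ∀ k, e k = D := by
      constructor
      · intro h k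
        ext i
        have := DFunLike.congr_fun h (k, i)
        simpa [Finsupp.finsetSum_apply, mapDomain_row_apply, hD] using this
      · intro h
        ext ⟨k, i⟩
        simp [Finsupp.finsetSum_apply, mapDomain_row_apply, h, hD]
    simp only [inRow, rename_monomial, coeff_monomial]
    rw [← monomial_sum_prod, coeff_monomial]
    simp only [hiff]
    by_cases h : ∀ k, e k = D
    · simp [h]
    · rw [if_neg h]
      push Not at h
      obtain ⟨k, hk⟩ := h
      exact (Finset.prod_eq_zero (Finset.mem_univ k) (if_neg hk)).symm
  have hexp : ∀ k, f k = ∑ e ∈ (f k).support, monomial e (coeff e (f k)) := fun k =>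
    (f k).as_sum
  calc coeff (balancedExp d) (∏ k, inRow k (f k))
      = coeff (balancedExp d)
          (∏ k, ∑ e ∈ (f k).support, inRow k (monomial e (coeff e (f k)))) := by
        congr 1
        refine Finset.prod_congr rfl fun k _ => ?_
        rw [← map_sum, ← hexp k]
    _ = ∏ k, coeff D (∑ e ∈ (f k).support, monomial e (coeff e (f k))) := by
        simp only [coeff_sum]
        rw [Finset.prod_univ_sum, Finset.prod_univ_sum, coeff_sum]
        exact Finset.sum_congr rfl fun e _ => hmon e fun k => coeff (e k) (f k)
    _ = _ := Finset.prod_congr rfl fun k _ => by rw [← hexp k]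

lemma map_genDet [Algebra ℝ R] : map (algebraMap ℝ R) genDet =
    (Matrix.of fun i k : Fin 3 => (X (k, i) : MvPolynomial (Fin 3 × Fin 3) R)).det := by
  simp only [genDet, evenPart, oddPart, Matrix.det_fin_three, Matrix.of_apply, map_sub, map_add,
    map_mul, map_X]
  ring

open Equiv.Perm in
/-- The determinant of the matrix of coefficients of `X p * X q * g`, symmetrised over the order of
its rows. -/
lemma six_mul_det_coeff [Algebra ℝ R] (d : Fin 3 → ℕ) (g : MvPolynomial (Fin 3) R) :
    6 * (Matrix.of fun p q : Fin 3 =>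
        coeff (Finsupp.equivFunOnFinite.symm d) (X p * X q * g)).det =
      coeff (balancedExp d) (map (algebraMap ℝ R) (genDet ^ 2) * ∏ k, inRow k g) := by
  set M := Matrix.of fun p q : Fin 3 =>
    coeff (Finsupp.equivFunOnFinite.symm d) (X p * X q * g) with hM
  have h1 : ∀ τ : Equiv.Perm (Fin 3),
      ∑ σ : Equiv.Perm (Fin 3), ((sign σ : ℤ) : R) * ∏ k, M (σ k) (τ k) = (sign τ : ℤ) * M.det := by
    intro τ
    rw [← Matrix.det_permute', Matrix.det_apply']
    rfl
  have h2 : 6 * M.det = ∑ τ : Equiv.Perm (Fin 3), ∑ σ : Equiv.Perm (Fin 3),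
      ((sign τ : ℤ) : R) * (((sign σ : ℤ) : R) * ∏ k, M (σ k) (τ k)) := by
    simp only [← Finset.mul_sum, h1]
    have : ∀ τ : Equiv.Perm (Fin 3),
        ((sign τ : ℤ) : R) * ((sign τ : ℤ) * M.det) = M.det := by
      intro τ
      rw [← mul_assoc, ← Int.cast_mul, ← Units.val_mul, Int.units_mul_self]
      simp
    simp only [this, Finset.sum_const, Finset.card_univ, Fintype.card_perm, Fintype.card_fin]
    norm_num [Nat.factorial]
  rw [h2, map_pow, map_genDet, sq, Matrix.det_apply', Finset.sum_mul_sum, Finset.sum_mul,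
    coeff_sum]
  refine Finset.sum_congr rfl fun τ _ => ?_
  rw [Finset.sum_mul, coeff_sum]
  refine Finset.sum_congr rfl fun σ _ => ?_
  have h3 : ∏ k, M (σ k) (τ k) =
      coeff (balancedExp d) (∏ k, inRow k (X (σ k) * X (τ k) * g)) := by
    rw [coeff_prod_inRow]; rfl
  rw [h3, ← coeff_C_mul, ← coeff_C_mul]
  congr 1
  simp only [map_mul, inRow_X, Finset.prod_mul_distrib, Matrix.of_apply, map_intCast]
  ring

/-- The linear form with coefficients `v`. -/
def linForm (v : Fin 3 → R) : MvPolynomial (Fin 3) R := ∑ i, C (v i) * X i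

/-- A linear form taken once in each row expands into symmetrised columns. -/
lemma six_mul_prod_inRow_linForm [Algebra ℝ R] (v : Fin 3 → R) :
    6 * ∏ k, inRow k (linForm v) = ∑ t : Fin 3 × Fin 3 × Fin 3,
      C (v t.1 * v t.2.1 * v t.2.2) * map (algebraMap ℝ R) (rowSym t.1 t.2.1 t.2.2) := by
  simp only [Fintype.sum_prod_type, linForm, Fin.prod_univ_three, Fin.sum_univ_three, map_add,
    map_mul, inRow_C, inRow_X, rowSym, map_X]
  ring

lemma six_mul_det_coeff_prod_linForm [Algebra ℝ R] {ι : Type*} [Fintype ι] [DecidableEq ι]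
    (d : Fin 3 → ℕ) (v : ι → Fin 3 → R) :
    6 ^ (Fintype.card ι + 1) * (Matrix.of fun p q : Fin 3 =>
        coeff (Finsupp.equivFunOnFinite.symm d) (X p * X q * ∏ o, linForm (v o))).det =
      ∑ t : ι → Fin 3 × Fin 3 × Fin 3, (∏ o, v o (t o).1 * v o (t o).2.1 * v o (t o).2.2) *
        algebraMap ℝ R (coeff (balancedExp d)
          (genDet ^ 2 * colProd (Finset.univ.val.map t))) := by
  have hexp : 6 ^ Fintype.card ι * ∏ k, inRow k (∏ o, linForm (v o)) =
      ∑ t : ι → Fin 3 × Fin 3 × Fin 3, C (∏ o, v o (t o).1 * v o (t o).2.1 * v o (t o).2.2) *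
        map (algebraMap ℝ R) (colProd (Finset.univ.val.map t)) := by
    simp only [map_prod]
    rw [Finset.prod_comm, ← Finset.card_univ, ← Finset.prod_const, ← Finset.prod_mul_distrib]
    simp only [six_mul_prod_inRow_linForm]
    rw [Finset.prod_univ_sum]
    simp only [Fintype.piFinset_univ, Finset.prod_mul_distrib, colProd, Multiset.map_map,
      Function.comp_apply, map_mul]
    refine Finset.sum_congr rfl fun t _ => ?_
    congr 1
    rw [← map_prod]; rfl
  rw [pow_succ, mul_assoc, six_mul_det_coeff, show (6 : R) ^ Fintype.card ι *
    coeff (balancedExp d) (map (algebraMap ℝ R) (genDet ^ 2) *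
      ∏ k, inRow k (∏ o, linForm (v o))) = coeff (balancedExp d)
      (map (algebraMap ℝ R) (genDet ^ 2) * (6 ^ Fintype.card ι *
        ∏ k, inRow k (∏ o, linForm (v o)))) by
    rw [← coeff_C_mul, map_pow, show (C 6 : MvPolynomial (Fin 3 × Fin 3) R) = 6 from rfl]
    congr 1; ring]
  rw [hexp, Finset.mul_sum, coeff_sum]
  refine Finset.sum_congr rfl fun t _ => ?_
  rw [mul_left_comm, coeff_C_mul, ← map_mul, coeff_map]

end RowCopies

/-! ### Coefficientwise differentiation and the theorem -/

/-- The product rule for differentiating the coefficients of a polynomial whose coefficients are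
themselves polynomials. -/
lemma pderiv_coeff_mul {σ τ : Type*} {v : τ} {f f' g g' : MvPolynomial σ (MvPolynomial τ ℝ)}
    (hf : ∀ e, pderiv v (coeff e f) = coeff e f') (hg : ∀ e, pderiv v (coeff e g) = coeff e g')
    (e : σ →₀ ℕ) : pderiv v (coeff e (f * g)) = coeff e (f' * g + f * g') := by
  classical
  simp only [coeff_add, coeff_mul, map_sum, Derivation.leibniz, smul_eq_mul, hf, hg,
    ← Finset.sum_add_distrib]
  exact Finset.sum_congr rfl fun _ _ => by ring

lemma pderiv_coeff_linForm {τ : Type*} (v : τ) (w : Fin 3 → MvPolynomial τ ℝ) (e : Fin 3 →₀ ℕ) :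
    pderiv v (coeff e (linForm w)) = coeff e (linForm fun i => pderiv v (w i)) := by
  simp only [linForm, coeff_sum, map_sum, coeff_C_mul, coeff_X, Derivation.leibniz, smul_eq_mul]
  refine Finset.sum_congr rfl fun i _ => ?_
  split_ifs <;> simp

lemma pderiv_coeff_prod_eq_zero {σ τ ι : Type*} {v : τ} (s : Finset ι)
    {f : ι → MvPolynomial σ (MvPolynomial τ ℝ)}
    (hf : ∀ i ∈ s, ∀ e, pderiv v (coeff e (f i)) = 0) (e : σ →₀ ℕ) :
    pderiv v (coeff e (∏ i ∈ s, f i)) = 0 := by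
  classical
  induction s using Finset.induction_on generalizing e with
  | empty => rw [Finset.prod_empty, coeff_one]; split_ifs <;> simp
  | insert i s hi ih =>
    rw [Finset.prod_insert hi, pderiv_coeff_mul (f' := 0) (g' := 0)]
    · simp
    · simpa using hf i (Finset.mem_insert_self i s)
    · simpa using ih fun j hj => hf j (Finset.mem_insert_of_mem hj)

/-- The coefficient vectors of the linear forms left in `F` after two differentiations: `x`, and
`(a_j, b_j, c_j)` for each `j`. -/
def formVec (r : ℕ) : Option (Fin r) → Fin 3 → MvPolynomial (CubicVar r) ℝ
  | none => fun i => X (Sum.inl i)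
  | some j => fun i => X (Sum.inr (i, j))

lemma hessianMatrix_eq (r : ℕ) (d : Fin 3 → ℕ) :
    hessianMatrix r d = (6 : MvPolynomial (CubicVar r) ℝ) • Matrix.of fun p q : Fin 3 =>
      coeff (Finsupp.equivFunOnFinite.symm d) (X p * X q * ∏ o, linForm (formVec r o)) := by
  set L := linForm (formVec r none) with hLdef
  set Q := ∏ j : Fin r, linForm (formVec r (some j)) with hQdef
  have hP : formalProduct r = L ^ 3 * Q := rfl
  have hL : ∀ p e, pderiv (Sum.inl p) (coeff e L) = coeff e (X p) := by
    intro p e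
    have h : (linForm fun i => pderiv (Sum.inl p) (formVec r none i)) = X p := by
      simp [linForm, formVec, pderiv_X, Pi.single_apply, ite_mul]
    rw [hLdef, pderiv_coeff_linForm, h]
  have hQ : ∀ p e, pderiv (Sum.inl p) (coeff e Q) = coeff e 0 := by
    intro p e
    rw [coeff_zero]
    refine pderiv_coeff_prod_eq_zero _ (fun j _ e => ?_) e
    rw [pderiv_coeff_linForm]
    simp [linForm, formVec, pderiv_X]
  have hX : ∀ (p q : Fin 3) e, pderiv (Sum.inl p : CubicVar r)
      (coeff e (X q : MvPolynomial (Fin 3) (MvPolynomial (CubicVar r) ℝ))) = coeff e 0 := by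
    intro p q e
    rw [coeff_X]
    split_ifs <;> simp
  refine Matrix.ext fun p q => ?_
  simp only [hessianMatrix, cubicF, Matrix.of_apply, Matrix.smul_apply, smul_eq_mul, hP,
    Fintype.prod_option]
  have h1 := pderiv_coeff_mul (pderiv_coeff_mul (pderiv_coeff_mul (hL q) (hL q)) (hL q)) (hQ q)
  have e1 : L ^ 3 * Q = L * L * L * Q := by ring
  have e2 : ((X q * L + L * X q) * L + L * L * X q) * Q + L * L * L * 0 =
      C 3 * (L * L * X q * Q) := by
    rw [show (C 3 : MvPolynomial (Fin 3) (MvPolynomial (CubicVar r) ℝ)) = 3 from rfl]; ring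
  have h2 := pderiv_coeff_mul (pderiv_coeff_mul (pderiv_coeff_mul (hL p) (hL p)) (hX p q)) (hQ p)
  have e3 : ((X p * L + L * X p) * X q + L * L * 0) * Q + L * L * X q * 0 =
      C 2 * (X p * X q * (L * Q)) := by
    rw [show (C 2 : MvPolynomial (Fin 3) (MvPolynomial (CubicVar r) ℝ)) = 2 from rfl]; ring
  rw [e1, h1, e2, coeff_C_mul, Derivation.leibniz, h2, e3, coeff_C_mul,
    show (3 : MvPolynomial (CubicVar r) ℝ) = C 3 from rfl, pderiv_C,
    show (C 3 : MvPolynomial (CubicVar r) ℝ) = 3 from rfl]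
  simp only [smul_eq_mul]
  ring

/-- The polynomials all of whose coefficients are nonnegative. -/
def nonnegCoeffs (σ : Type*) : Subsemiring (MvPolynomial σ ℝ) where
  carrier := {f | ∀ m, 0 ≤ coeff m f}
  zero_mem' := fun m => by simp
  one_mem' := fun m => by
    classical
    rw [coeff_one]; split_ifs <;> simp
  add_mem' := fun hf hg m => by
    rw [coeff_add]; exact add_nonneg (hf m) (hg m)
  mul_mem' := fun hf hg m => by
    classical
    rw [coeff_mul]; exact Finset.sum_nonneg fun x _ => mul_nonneg (hf x.1) (hg x.2)

lemma C_mem_nonnegCoeffs {σ : Type*} {a : ℝ} (ha : 0 ≤ a) : C a ∈ nonnegCoeffs σ := fun m => by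
  classical
  rw [coeff_C]; split_ifs <;> simp [ha]

lemma X_mem_nonnegCoeffs {σ : Type*} (i : σ) : X i ∈ nonnegCoeffs σ := fun m => by
  classical
  rw [coeff_X]; split_ifs <;> simp

lemma formVec_mem_nonnegCoeffs (r : ℕ) (o : Option (Fin r)) (i : Fin 3) :
    formVec r o i ∈ nonnegCoeffs (CubicVar r) := by
  cases o <;> exact X_mem_nonnegCoeffs _

lemma coeff_hessianDet_nonneg (r : ℕ) (d : Fin 3 → ℕ) (m : CubicVar r →₀ ℕ) :
    0 ≤ coeff m (hessianDet r d) := by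
  have h := six_mul_det_coeff_prod_linForm d (formVec r)
  have hmem : ∑ t : Option (Fin r) → Fin 3 × Fin 3 × Fin 3,
      (∏ o, formVec r o (t o).1 * formVec r o (t o).2.1 * formVec r o (t o).2.2) *
        algebraMap ℝ (MvPolynomial (CubicVar r) ℝ) (coeff (balancedExp d)
          (genDet ^ 2 * colProd (Finset.univ.val.map t))) ∈ nonnegCoeffs (CubicVar r) :=
    sum_mem fun t _ => mul_mem (prod_mem fun o _ => mul_mem (mul_mem
      (formVec_mem_nonnegCoeffs r o _) (formVec_mem_nonnegCoeffs r o _))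
      (formVec_mem_nonnegCoeffs r o _))
      (C_mem_nonnegCoeffs (coeff_genDet_sq_mul_colProd_nonneg _ d))
  rw [← h, show (6 : MvPolynomial (CubicVar r) ℝ) = C 6 from rfl, ← C_pow] at hmem
  have hm := hmem m
  rw [coeff_C_mul] at hm
  rw [hessianDet, hessianMatrix_eq, Matrix.det_smul,
    show (6 : MvPolynomial (CubicVar r) ℝ) = C 6 from rfl, ← C_pow, coeff_C_mul]
  exact mul_nonneg (by positivity) (nonneg_of_mul_nonneg_right hm (by positivity))

end

theorem theorem3p2 (r : ℕ) (d : Fin 3 → ℕ) (hpos : ∀ i, 0 < d i)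
    (hsum : d 0 + d 1 + d 2 = r + 3) :
    ∀ m ∈ (hessianDet r d).support, 0 < (hessianDet r d).coeff m := by
  intro m hm
  exact lt_of_le_of_ne (coeff_hessianDet_nonneg r d m) (mem_support_iff.1 hm).symm
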